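/- Let $(\mathbb{Z}^2,\ell^1)$ be the grid graph: its vertices are the points of $\mathbb{Z}^2$, and two points are adjacent iff their $\ell^1$-distance is $1$; write $E$ for its set of (undirected) edges. For $f:\mathbb{Z}^2\to\mathbb{R}_{\ge 0}$ put $$\|\nabla f\|_{L^1}=\sum_{\{v,w\}\in E}|f(v)-f(w)|\in[0,\infty],\qquad \|\nabla f\|_{L^\infty}=\sup_{\{v,w\}\in E}|f(v)-f(w)|\in[0,\infty].$$ Let $v_1,v_2,v_3,\dots$ be the enumeration of $\mathbb{Z}^2$ along the counterclockwise square spiral around the origin, $$(0,0),(1,0),(1,1),(0,1),(-1,1),(-1,0),(-1,-1),(0,-1),(1,-1),(2,-1),(2,0),(2,1),(2,2),(1,2),\dots$$ For a bounded function $f:\mathbb{Z}^2\to\mathbb{R}_{\ge 0}$, its spiral rearrangement $f^*:\mathbb{Z}^2\to\mathbb{R}_{\ge 0}$ is defined by letting $f^*(v_k)$ be the $k$-th largest value of $f$, counted with multiplicity, that is, $$f^*(v_k)=\sup\bigl\{s\ge 0:\ \#\{x\in\mathbb{Z}^2: f(x)\ge s\}\ge k\bigr\}.$$ Theorem 1.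 For every bounded $f:\mathbb{Z}^2\to\mathbb{R}_{\ge 0}$, $$\|\nabla f^*\|_{L^1}\le\|\nabla f\|_{L^1}\qquad\text{and}\qquad\|\nabla f^*\|_{L^\infty}\le 2\,\|\nabla f\|_{L^\infty}.$$ -/

import Mathlib

open scoped NNReal ENNReal

/-- The grid graph `(ℤ², ℓ¹)`: two lattice points are adjacent when their `ℓ¹` distance is `1`. -/
def gridGraph : SimpleGraph (ℤ × ℤ) where
  Adj p q := |p.1 - q.1| + |p.2 - q.2| = 1
  symm := ⟨fun p q h => by rwa [abs_sub_comm q.1 p.1, abs_sub_comm q.2 p.2]⟩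
  loopless := ⟨fun p h => by simp at h⟩

section Gradient

variable {V : Type*}

/-- The modulus `|∇f|` of the discrete gradient: on the unordered pair `{v, w}` it is
`|f v - f w|`. -/
noncomputable def absGrad (f : V → ℝ≥0) : Sym2 V → ℝ≥0∞ :=
  Sym2.lift ⟨fun v w => ENNReal.ofReal |(f v : ℝ) - (f w : ℝ)|,
    fun v w => by simp only [abs_sub_comm]⟩

/-- `‖∇f‖_{L¹}`, the sum of `|f v - f w|` over all edges, with values in `[0, ∞]`. -/
noncomputable def gradL1 (G : SimpleGraph V) (f : V → ℝ≥0) : ℝ≥0∞ :=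
  ∑' e : G.edgeSet, absGrad f e

/-- `‖∇f‖_{L^∞}`, the supremum of `|f v - f w|` over all edges, with values in `[0, ∞]`. -/
noncomputable def gradLinf (G : SimpleGraph V) (f : V → ℝ≥0) : ℝ≥0∞ :=
  ⨆ e : G.edgeSet, absGrad f e

/-- The `k`-th largest value of `f` (for `k ≥ 1`, counted with multiplicity): the supremum of all
levels `s` such that `f ≥ s` on at least `k` points. If `f` assumes a value `t` with
`#{f > t} < k ≤ #{f ≥ t}`, i.e. a `k`-th largest value in the literal sense, the supremum is `t`.
It is meaningful for bounded `f` on an infinite set. -/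
noncomputable def kthLargest (f : V → ℝ≥0) (k : ℕ) : ℝ≥0 :=
  sSup {s : ℝ≥0 | (k : ℕ∞) ≤ {x : V | s ≤ f x}.encard}

/-- The rearrangement `f*` of `f` along an enumeration `v 0, v 1, v 2, …` of the vertices:
`f* (v k)` is the `(k + 1)`-st largest value of `f`. -/
noncomputable def rearrangement (v : ℕ ≃ V) (f : V → ℝ≥0) (x : V) : ℝ≥0 :=
  kthLargest f (v.symm x + 1)

end Gradient

/-- One step along the counterclockwise square spiral around the origin:
up along the right sides, left along the top sides, down along the left sides,
right along the bottom sides (and one step further, onto the next ring). -/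
def spiralNext (p : ℤ × ℤ) : ℤ × ℤ :=
  if -p.1 < p.2 ∧ p.2 < p.1 then (p.1, p.2 + 1)
  else if -p.2 < p.1 ∧ p.1 ≤ p.2 then (p.1 - 1, p.2)
  else if p.1 < p.2 ∧ p.2 ≤ -p.1 then (p.1, p.2 - 1)
  else (p.1 + 1, p.2)

/-- The `k`-th point of the spiral, starting with `spiralPoint 0 = (0, 0)`. -/
def spiralPoint (k : ℕ) : ℤ × ℤ := spiralNext^[k] (0, 0)

/-- Closed form of the position of a lattice point on the spiral (used for bijectivity). -/
def spiralIndex (p : ℤ × ℤ) : ℤ :=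
  if -p.1 < p.2 ∧ p.2 < p.1 then 4 * p.1 ^ 2 - 3 * p.1 + p.2
  else if -p.2 < p.1 ∧ p.1 ≤ p.2 then 4 * p.2 ^ 2 - p.2 - p.1
  else if p.1 < p.2 ∧ p.2 ≤ -p.1 then 4 * p.1 ^ 2 - p.1 - p.2
  else 4 * p.2 ^ 2 - 3 * p.2 + p.1

theorem spiralIndex_next (p : ℤ × ℤ) : spiralIndex (spiralNext p) = spiralIndex p + 1 := by
  obtain ⟨x, y⟩ := p
  unfold spiralNext
  dsimp only
  split_ifs with h1 h2 h3
  · by_cases hy : y + 1 = x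
    · subst hy
      rw [spiralIndex, spiralIndex]; dsimp only
      rw [if_neg (by omega), if_pos (by omega), if_pos (by omega)]; ring
    · rw [spiralIndex, spiralIndex]; dsimp only
      rw [if_pos (by omega), if_pos (by omega)]; ring
  · by_cases hx : x - 1 = -y
    · obtain rfl : x = 1 - y := by omega
      rw [spiralIndex, spiralIndex]; dsimp only
      rw [if_neg (by omega), if_neg (by omega), if_pos (by omega), if_neg (by omega),
        if_pos (by omega)]; ring
    · rw [spiralIndex, spiralIndex]; dsimp only
      rw [if_neg (by omega), if_pos (by omega), if_neg (by omega), if_pos (by omega)]; ring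
  · by_cases hy : y - 1 = x
    · obtain rfl : y = x + 1 := by omega
      rw [spiralIndex, spiralIndex]; dsimp only
      rw [if_neg (by omega), if_neg (by omega), if_neg (by omega), if_neg (by omega),
        if_neg (by omega), if_pos (by omega)]; ring
    · rw [spiralIndex, spiralIndex]; dsimp only
      rw [if_neg (by omega), if_neg (by omega), if_pos (by omega), if_neg (by omega),
        if_neg (by omega), if_pos (by omega)]; ring
  · by_cases hx : x = -y
    · subst hx
      rw [spiralIndex, spiralIndex]; dsimp only
      rw [if_neg (c := -(-y) < y ∧ y < -y) (by omega), if_neg (c := -y < -y ∧ -y ≤ y) (by omega),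
        if_neg (c := -y < y ∧ y ≤ -(-y)) (by omega), if_pos (by omega)]; ring
    · rw [spiralIndex, spiralIndex]; dsimp only
      rw [if_neg (by omega), if_neg (by omega), if_neg (by omega), if_neg (by omega),
        if_neg (by omega), if_neg (by omega)]; ring

theorem spiralIndex_pos (p : ℤ × ℤ) (hp : p ≠ (0, 0)) : 0 < spiralIndex p := by
  obtain ⟨x, y⟩ := p
  have hp : ¬ (x = 0 ∧ y = 0) := by simpa using hp
  unfold spiralIndex
  dsimp only
  split_ifs with h1 h2 h3
  · nlinarith
  · have : 1 ≤ y := by omega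
    nlinarith
  · nlinarith
  · have : y ≤ -1 := by omega
    have : y ≤ x := by omega
    nlinarith

theorem exists_spiralNext (p : ℤ × ℤ) (hp : p ≠ (0, 0)) : ∃ q, spiralNext q = p := by
  obtain ⟨x, y⟩ := p
  have hp : ¬ (x = 0 ∧ y = 0) := by simpa using hp
  by_cases h1 : 1 - x < y ∧ y ≤ x
  · refine ⟨(x, y - 1), ?_⟩
    rw [spiralNext]; dsimp only
    rw [if_pos (by omega)]; simp
  by_cases h2 : -y ≤ x ∧ x < y
  · refine ⟨(x + 1, y), ?_⟩
    rw [spiralNext]; dsimp only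
    rw [if_neg (by omega), if_pos (by omega)]; simp
  by_cases h3 : x ≤ y ∧ y < -x
  · refine ⟨(x, y + 1), ?_⟩
    rw [spiralNext]; dsimp only
    rw [if_neg (by omega), if_neg (by omega), if_pos (by omega)]; simp
  · refine ⟨(x - 1, y), ?_⟩
    rw [spiralNext]; dsimp only
    rw [if_neg (by omega), if_neg (by omega), if_neg (by omega)]; simp

theorem spiralIndex_spiralPoint (k : ℕ) : spiralIndex (spiralPoint k) = k := by
  induction k with
  | zero => simp [spiralPoint, spiralIndex]
  | succ k ih =>
    have : spiralPoint (k + 1) = spiralNext (spiralPoint k) :=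
      Function.iterate_succ_apply' _ _ _
    rw [this, spiralIndex_next, ih]; push_cast; ring

theorem spiralPoint_of_index (k : ℕ) : ∀ p, spiralIndex p = k → spiralPoint k = p := by
  induction k with
  | zero =>
    intro p hp
    by_contra h
    have := spiralIndex_pos p (fun h' => h (by rw [h']; rfl))
    simp at hp; omega
  | succ k ih =>
    intro p hp
    have h0 : p ≠ (0, 0) := by
      rintro rfl
      simp [spiralIndex] at hp
      omega
    obtain ⟨q, rfl⟩ := exists_spiralNext p h0
    rw [spiralIndex_next] at hp
    have := ih q (by push_cast at hp; omega)
    rw [← this]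
    exact Function.iterate_succ_apply' _ _ _

theorem spiralPoint_bijective : Function.Bijective spiralPoint := by
  constructor
  · intro j k h
    have := spiralIndex_spiralPoint j
    rw [h, spiralIndex_spiralPoint] at this
    exact_mod_cast this.symm
  · intro p
    have h0 : 0 ≤ spiralIndex p := by
      by_cases hp : p = (0, 0)
      · subst hp; simp [spiralIndex]
      · exact (spiralIndex_pos p hp).le
    exact ⟨(spiralIndex p).toNat, spiralPoint_of_index _ p (by omega)⟩

/-- The spiral, as an enumeration of all of `ℤ²`. -/
noncomputable def spiral : ℕ ≃ ℤ × ℤ := Equiv.ofBijective spiralPoint spiralPoint_bijective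

/-!
The superlevel sets `{f* > s}` of the rearrangement are the initial segments of the spiral with the
cardinality of `{f > s}`, or the whole plane when `{f > s}` is infinite
(`superlevel_rearrangement_of_finite`, `superlevel_rearrangement_of_infinite`). Both inequalities
therefore follow from isoperimetric properties of these segments.

For `L¹`, the coarea formula `gradL1_eq_lintegral_edgeBoundary` reduces the claim to the edge
isoperimetric inequality: among the sets with `n` points, the first `n` points of the spiral have
the fewest boundary edges. A finite set that meets `a` columns and `b` rows has at least `2 (a + b)`
boundary edges, since each line that meets the set is left at both ends, and it has at most `ab`
points. For a segment of the spiral the bound `2 (a + b)` is attained, because along each row and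
each column the position on the spiral first decreases and then increases (`IsValley`), so that
lines meet the segment in intervals. Moreover, a segment of `n` points has the smallest `a + b`
compatible with `n ≤ ab`: the spiral reaches its `(m + 1)`-st line (rows and columns counted
together, from `m = 0`) at the position `⌊m² / 4⌋` (`card_image_spiralSegment_le`).

For `L^∞`, let `δ` be the largest gradient of `f`, let `p`, `q` be adjacent, at positions `j` and
`k`, and let `A` be a set of `j + 1` points where `f ≥ t`. Then `f ≥ t - 2δ` on all points within
distance two of `A`. Each passage to the neighbourhood adds two points per column and two further
columns, and the same holds for rows, so there are at least `|A| + 4m + 4` such points for some `m`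
with `m² ≥ |A|` (`ContainsNbhd.exists_card_le_sq`). Neighbours lie on the same ring or on
consecutive rings of the spiral, whence `k ≤ j + 4m + 4` (`spiralIndex_le_of_adj`), and `f* q` is
at least `t - 2δ`.
-/

/-! ### The rearrangement and its superlevel sets -/

section Rearrangement

variable {V : Type*}

theorem bddAbove_levels {f : V → ℝ≥0} (hf : BddAbove (Set.range f)) (k : ℕ) :
    BddAbove {s : ℝ≥0 | ((k + 1 : ℕ) : ℕ∞) ≤ {x : V | s ≤ f x}.encard} := by
  obtain ⟨M, hM⟩ := hf
  refine ⟨M, fun s hs => ?_⟩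
  have hne : {x : V | s ≤ f x}.Nonempty := by
    rw [← Set.encard_pos]
    exact lt_of_lt_of_le (by simp) hs
  obtain ⟨x, hx⟩ := hne
  exact le_trans hx (hM ⟨x, rfl⟩)

theorem nonempty_levels [Infinite V] (f : V → ℝ≥0) (k : ℕ) :
    {s : ℝ≥0 | (k : ℕ∞) ≤ {x : V | s ≤ f x}.encard}.Nonempty :=
  ⟨0, by simp [Set.encard_univ]⟩

/-- The `k`-th largest value exceeds `s` exactly when `f` does so at `k` points. The strict
inequalities matter: `f` may approach a level at infinitely many points without reaching it. -/
theorem lt_kthLargest_iff [Infinite V] {f : V → ℝ≥0} (hf : BddAbove (Set.range f)) (k : ℕ)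
    (s : ℝ≥0) :
    s < kthLargest f (k + 1) ↔ ((k + 1 : ℕ) : ℕ∞) ≤ {x : V | s < f x}.encard := by
  constructor
  · intro h
    obtain ⟨t, ht, hst⟩ := exists_lt_of_lt_csSup (nonempty_levels f (k + 1)) h
    exact le_trans ht (Set.encard_le_encard fun x hx => lt_of_lt_of_le hst hx)
  · intro h
    obtain ⟨A, hA, hcard⟩ := Set.exists_subset_encard_eq h
    have hfin : A.Finite := Set.finite_of_encard_eq_coe hcard
    have hne : A.Nonempty := by
      rw [← Set.encard_pos, hcard]; simp
    obtain ⟨a, ha, hmin⟩ := hfin.exists_minimalFor f A hne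
    refine lt_of_lt_of_le (hA ha) (le_csSup (bddAbove_levels hf k) ?_)
    rw [Set.mem_ofPred_eq, ← hcard]
    refine Set.encard_le_encard fun x hx => ?_
    rcases le_total (f a) (f x) with h' | h'
    · exact h'
    · exact hmin hx h'

theorem superlevel_rearrangement_of_finite [Infinite V] {f : V → ℝ≥0}
    (hf : BddAbove (Set.range f)) (v : ℕ ≃ V) {s : ℝ≥0} {A : Finset V}
    (hA : {x | s < f x} = A) :
    {x | s < rearrangement v f x} = {x | v.symm x < A.card} := by
  ext x
  simp only [Set.mem_ofPred_eq, rearrangement]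
  rw [lt_kthLargest_iff hf, hA, Set.encard_coe_eq_coe_finsetCard]
  norm_cast

theorem superlevel_rearrangement_of_infinite [Infinite V] {f : V → ℝ≥0}
    (hf : BddAbove (Set.range f)) (v : ℕ ≃ V) {s : ℝ≥0} (hA : {x | s < f x}.Infinite) :
    {x | s < rearrangement v f x} = Set.univ := by
  ext x
  simp only [Set.mem_ofPred_eq, rearrangement, Set.mem_univ, iff_true]
  rw [lt_kthLargest_iff hf, hA.encard_eq]
  exact le_top

end Rearrangement

/-! ### The coarea formula -/

section Coarea

variable {V : Type*}

/-- The pairs separated by `A`: one member lies in `A`, the other outside. -/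
def separatedPairs (A : Set V) : Set (Sym2 V) :=
  {e | (∃ v ∈ e, v ∈ A) ∧ ∃ w ∈ e, w ∉ A}

/-- The edge boundary of `A`: the edges of `G` with one end in `A` and the other outside. -/
def edgeBoundary (G : SimpleGraph V) (A : Set V) : Set (Sym2 V) :=
  G.edgeSet ∩ separatedPairs A

@[simp] theorem edgeBoundary_univ (G : SimpleGraph V) : edgeBoundary G Set.univ = ∅ := by
  simp [edgeBoundary, separatedPairs]

theorem mk_mem_separatedPairs {A : Set V} {v w : V} :
    s(v, w) ∈ separatedPairs A ↔ (v ∈ A ∧ w ∉ A) ∨ (w ∈ A ∧ v ∉ A) := by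
  simp only [separatedPairs, Set.mem_ofPred_eq, Sym2.mem_iff, exists_eq_or_imp, exists_eq_left]
  tauto

/-- A pair is separated by the superlevel sets at the levels between its two values. -/
theorem indicator_separatedPairs (f : V → ℝ≥0) (v w : V) :
    (fun s : ℝ => (separatedPairs {x | s < f x}).indicator (1 : Sym2 V → ℝ≥0∞) s(v, w)) =
      (Set.Ico (min (f v : ℝ) (f w)) (max (f v : ℝ) (f w))).indicator 1 := by
  classical
  funext s
  simp only [Set.indicator_apply, Pi.one_apply]
  refine if_congr ?_ rfl rfl
  simp only [mk_mem_separatedPairs, Set.mem_ofPred_eq, Set.mem_Ico, not_lt, min_le_iff, lt_max_iff]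
  grind

theorem measurable_indicator_separatedPairs (f : V → ℝ≥0) (e : Sym2 V) :
    Measurable fun s : ℝ => (separatedPairs {x | s < f x}).indicator (1 : Sym2 V → ℝ≥0∞) e := by
  induction e using Sym2.ind with
  | _ v w =>
    rw [indicator_separatedPairs]
    exact measurable_one.indicator measurableSet_Ico

theorem absGrad_eq_lintegral (f : V → ℝ≥0) (e : Sym2 V) :
    absGrad f e = ∫⁻ s : ℝ, (separatedPairs {x | s < f x}).indicator 1 e := by
  induction e using Sym2.ind with
  | _ v w =>
    rw [indicator_separatedPairs, MeasureTheory.lintegral_indicator_one measurableSet_Ico,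
      Real.volume_Ico, max_sub_min_eq_abs', absGrad, Sym2.lift_mk]

/-- Coarea formula: `‖∇f‖_{L¹}` is the integral over all levels of the size of the edge boundary
of the superlevel set. -/
theorem gradL1_eq_lintegral_edgeBoundary [Countable V] (G : SimpleGraph V) (f : V → ℝ≥0) :
    gradL1 G f = ∫⁻ s : ℝ, ((edgeBoundary G {x | s < (f x : ℝ)}).encard : ℝ≥0∞) := by
  have hV : Countable (Sym2 V) := by unfold Sym2; infer_instance
  rw [gradL1, tsum_congr fun e : G.edgeSet => absGrad_eq_lintegral f e,
    ← MeasureTheory.lintegral_tsum fun e : G.edgeSet =>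
      (measurable_indicator_separatedPairs f e).aemeasurable]
  refine MeasureTheory.lintegral_congr fun s => ?_
  rw [tsum_subtype G.edgeSet (Set.indicator _ 1), Set.indicator_indicator, ← tsum_subtype]
  exact ENNReal.tsum_set_one _

end Coarea

/-! ### The position on the spiral along rows and columns -/

theorem spiralIndex_lt_right {x y : ℤ} (h : y ≤ x) :
    spiralIndex (x, y) < spiralIndex (x + 1, y) := by
  simp only [spiralIndex]
  split_ifs <;> first | omega | nlinarith

theorem spiralIndex_lt_left {x y : ℤ} (h : x ≤ y) :
    spiralIndex (x, y) < spiralIndex (x - 1, y) := by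
  simp only [spiralIndex]
  split_ifs <;> first | omega | nlinarith

theorem spiralIndex_lt_up {x y : ℤ} (h : -x ≤ y) (h' : 0 < x → 1 - x ≤ y) :
    spiralIndex (x, y) < spiralIndex (x, y + 1) := by
  rcases eq_or_ne (x, y) (0, 0) with h0 | h0
  · simp only [Prod.mk.injEq] at h0
    simp [spiralIndex, h0.1, h0.2]
  have h0 : ¬(x = 0 ∧ y = 0) := by simpa using h0
  simp only [spiralIndex]
  split_ifs <;> first | omega | nlinarith

theorem spiralIndex_lt_down {x y : ℤ} (h : y ≤ 1 - x) (h' : x ≤ 0 → y ≤ -x) :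
    spiralIndex (x, y) < spiralIndex (x, y - 1) := by
  simp only [spiralIndex]
  split_ifs <;> first
    | omega
    | nlinarith
    | (have hv : y = x + 1 := by omega
       subst hv
       nlinarith)
    | (have : y ≤ 0 := by omega
       nlinarith)

theorem four_mul_spiralIndex_row (y : ℤ) : 4 * spiralIndex (y, y) = |4 * y - 1| ^ 2 - 1 := by
  rw [sq_abs]
  simp only [spiralIndex]
  split_ifs <;> first | omega | nlinarith

/-- The first point of the spiral in the column `x`. -/
def columnStart (x : ℤ) : ℤ × ℤ := (x, if 0 < x then 1 - x else -x)

theorem four_mul_spiralIndex_columnStart (x : ℤ) :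
    4 * spiralIndex (columnStart x) = (|4 * x - 1| - 1) ^ 2 := by
  rcases lt_or_ge 0 x with hx | hx
  · rw [columnStart, if_pos hx, abs_of_nonneg (by omega)]
    simp only [spiralIndex]
    split_ifs <;> first | omega | nlinarith
  · rw [columnStart, if_neg (by omega), abs_of_neg (by omega)]
    simp only [spiralIndex]
    split_ifs <;> first
      | omega
      | nlinarith
      | (have hv : x = 0 := by omega
         subst hv
         norm_num)

/-- The four unit steps of the grid. -/
def unitSteps : Finset (ℤ × ℤ) := {(1, 0), (-1, 0), (0, 1), (0, -1)}

theorem gridGraph_adj_iff {p q : ℤ × ℤ} : gridGraph.Adj p q ↔ ∃ d ∈ unitSteps, q = p + d := by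
  obtain ⟨x, y⟩ := p
  obtain ⟨x', y'⟩ := q
  have : gridGraph.Adj (x, y) (x', y') ↔ |x - x'| + |y - y'| = 1 := Iff.rfl
  simp only [this, unitSteps, Finset.mem_insert, Finset.mem_singleton, exists_eq_or_imp,
    exists_eq_left, Prod.mk_add_mk, Prod.mk.injEq]
  rcases abs_cases (x - x') with h | h <;> rcases abs_cases (y - y') with h' | h' <;> omega

/-- The square root of the position is at least about twice the distance from the origin. -/
theorem le_of_spiralIndex_lt_sq {x y m : ℤ} (hm : 0 ≤ m) (h : spiralIndex (x, y) < m ^ 2) :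
    2 * x ≤ m ∧ 2 * y ≤ m ∧ (x ≤ y → y ≤ -x → 1 - 2 * x ≤ m) ∧
      (y ≤ x → x ≤ -y → 1 - 2 * y ≤ m) := by
  refine ⟨?_, ?_, fun h₁ h₂ => ?_, fun h₁ h₂ => ?_⟩ <;> by_contra! hlt <;>
    simp only [spiralIndex] at h <;> split_ifs at h <;> first
      | omega
      | nlinarith
      | (have : m ≤ -2 * y := by omega
         nlinarith)
      | (have hv : y = x := by omega
         subst hv
         nlinarith)

/-- Neighbouring points lie on the same or on consecutive rings of the spiral, so their positions
differ by at most about four times the square root of the position. -/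
theorem spiralIndex_le_of_adj {p q : ℤ × ℤ} (h : gridGraph.Adj p q) {m : ℤ} (hm : 0 ≤ m)
    (hp : spiralIndex p < m ^ 2) : spiralIndex q ≤ spiralIndex p + 4 * m + 4 := by
  obtain ⟨x, y⟩ := p
  obtain ⟨h₁, h₂, h₃, h₄⟩ := le_of_spiralIndex_lt_sq hm hp
  obtain ⟨d, hd, rfl⟩ := gridGraph_adj_iff.1 h
  clear h hp
  -- Within a side of the spiral and across to the next ring the bounds on `m` suffice; the corners,
  -- where `y = x` or `y = -x`, need a substitution.
  simp only [unitSteps, Finset.mem_insert, Finset.mem_singleton] at hd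
  rcases hd with rfl | rfl | rfl | rfl
  · rcases le_or_gt y x with hxy | hxy
    · simp only [spiralIndex, Prod.mk_add_mk, add_zero]
      split_ifs <;> first
      | omega
      | nlinarith
      | (have := h₄ (by omega) (by omega)
         have hv : y = -x := by omega
         subst hv
         nlinarith)
    · have := spiralIndex_lt_left (x := x + 1) (y := y) (by omega)
      simp only [add_sub_cancel_right] at this
      simp only [Prod.mk_add_mk, add_zero]
      omega
  · rcases le_or_gt x y with hxy | hxy
    · simp only [spiralIndex, Prod.mk_add_mk, add_zero]
      split_ifs <;> first
      | omega
      | nlinarith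
      | (have := h₃ (by omega) (by omega)
         nlinarith)
      | (have := h₄ (by omega) (by omega)
         have hv : y = x := by omega
         subst hv
         nlinarith)
    · have := spiralIndex_lt_right (x := x - 1) (y := y) (by omega)
      simp only [sub_add_cancel] at this
      simp only [Prod.mk_add_mk, add_zero, ← sub_eq_add_neg]
      omega
  · simp only [spiralIndex, Prod.mk_add_mk, add_zero]
    split_ifs <;> first
      | omega
      | nlinarith
      | (have := h₄ (by omega) (by omega)
         have hv : y = -x := by omega
         subst hv
         nlinarith)
      | (have := h₄ (by omega) (by omega)
         have hv : y = x := by omega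
         subst hv
         nlinarith)
  · simp only [spiralIndex, Prod.mk_add_mk, add_zero]
    split_ifs <;> first
      | omega
      | nlinarith
      | (have := h₄ (by omega) (by omega)
         nlinarith)

/-! ### The edge boundary of a finite set of lattice points -/

section Perimeter

/-- The points of `A` from which the step `d` leaves `A`. -/
def exits (A : Finset (ℤ × ℤ)) (d : ℤ × ℤ) : Finset (ℤ × ℤ) := A.filter fun v => v + d ∉ A

theorem mem_exits {A : Finset (ℤ × ℤ)} {d v : ℤ × ℤ} : v ∈ exits A d ↔ v ∈ A ∧ v + d ∉ A := by
  simp [exits]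

theorem encard_edgeBoundary (A : Finset (ℤ × ℤ)) :
    (edgeBoundary gridGraph A).encard = (∑ d ∈ unitSteps, (exits A d).card : ℕ) := by
  rw [← Finset.card_sigma, ← Set.encard_coe_eq_coe_finsetCard]
  -- A boundary edge has exactly one orientation that leads out of `A`.
  have himage : edgeBoundary gridGraph A =
      (fun e : (_ : ℤ × ℤ) × ℤ × ℤ => s(e.2, e.2 + e.1)) '' (unitSteps.sigma (exits A)) := by
    ext e
    induction e using Sym2.ind with
    | _ v w =>
    simp only [edgeBoundary, Set.mem_inter_iff, SimpleGraph.mem_edgeSet, mk_mem_separatedPairs,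
      Set.mem_image, Finset.mem_coe, Finset.mem_sigma, mem_exits]
    constructor
    · rintro ⟨hadj, h | h⟩
      · obtain ⟨d, hd, rfl⟩ := gridGraph_adj_iff.1 hadj
        exact ⟨⟨d, v⟩, ⟨hd, h⟩, rfl⟩
      · obtain ⟨d, hd, rfl⟩ := gridGraph_adj_iff.1 hadj.symm
        exact ⟨⟨d, w⟩, ⟨hd, h⟩, Sym2.eq_swap⟩
    · rintro ⟨⟨d, u⟩, ⟨hd, h⟩, heq⟩
      have hadj : gridGraph.Adj u (u + d) := gridGraph_adj_iff.2 ⟨d, hd, rfl⟩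
      rcases Sym2.eq_iff.1 heq with ⟨rfl, rfl⟩ | ⟨rfl, rfl⟩
      · exact ⟨hadj, Or.inl h⟩
      · exact ⟨hadj.symm, Or.inr h⟩
  rw [himage, Set.InjOn.encard_image]
  rintro ⟨d, v⟩ hv ⟨d', v'⟩ hv' heq
  simp only [Finset.mem_coe, Finset.mem_sigma, mem_exits] at hv hv'
  rcases Sym2.eq_iff.1 heq with ⟨h₁, h₂⟩ | ⟨h₁, h₂⟩
  · simp only at h₁ h₂
    subst h₁
    rw [add_left_cancel h₂]
  · simp only at h₁ h₂
    exact absurd (h₁ ▸ hv.2.1) hv'.2.2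

theorem sum_unitSteps (F : ℤ × ℤ → ℕ) :
    ∑ d ∈ unitSteps, F d = F (1, 0) + F (-1, 0) + F (0, 1) + F (0, -1) := by
  rw [unitSteps, Finset.sum_insert (by decide), Finset.sum_insert (by decide),
    Finset.sum_insert (by decide), Finset.sum_singleton]
  ring

/-- Every line in direction `d` that meets `A` has a last point in `A`. Here `π` is constant on
these lines and `h` increases along them. -/
theorem card_image_le_card_exits (A : Finset (ℤ × ℤ)) {d : ℤ × ℤ} (π h : ℤ × ℤ → ℤ)
    (hπ : ∀ v, π (v + d) = π v) (hh : ∀ v, h v < h (v + d)) :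
    (A.image π).card ≤ (exits A d).card := by
  refine le_trans (Finset.card_le_card fun c hc => ?_) (Finset.card_image_le (f := π))
  obtain ⟨v, hv, rfl⟩ := Finset.mem_image.1 hc
  obtain ⟨w, hw, hmax⟩ := Finset.exists_max_image (A.filter fun w => π w = π v) h
    ⟨v, by simp [hv]⟩
  rw [Finset.mem_filter] at hw
  refine Finset.mem_image.2 ⟨w, mem_exits.2 ⟨hw.1, fun hmem => ?_⟩, hw.2⟩
  exact absurd (hmax (w + d) (by simp [hmem, hπ, hw.2])) (not_le.2 (hh w))

theorem two_mul_card_add_card_le_encard_edgeBoundary (A : Finset (ℤ × ℤ)) :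
    ((2 * ((A.image Prod.fst).card + (A.image Prod.snd).card) : ℕ) : ℕ∞) ≤
      (edgeBoundary gridGraph A).encard := by
  rw [encard_edgeBoundary, sum_unitSteps, Nat.cast_le]
  have h₁ := card_image_le_card_exits A (d := (1, 0)) Prod.snd Prod.fst (by simp) (by simp)
  have h₂ := card_image_le_card_exits A (d := (-1, 0)) Prod.snd (fun v => -v.1) (by simp) (by simp)
  have h₃ := card_image_le_card_exits A (d := (0, 1)) Prod.fst Prod.snd (by simp) (by simp)
  have h₄ := card_image_le_card_exits A (d := (0, -1)) Prod.fst (fun v => -v.2) (by simp) (by simp)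
  omega

theorem card_le_card_image_mul_card_image (A : Finset (ℤ × ℤ)) :
    A.card ≤ (A.image Prod.fst).card * (A.image Prod.snd).card := by
  rw [← Finset.card_product]
  exact Finset.card_le_card fun v hv =>
    Finset.mem_product.2 ⟨Finset.mem_image_of_mem _ hv, Finset.mem_image_of_mem _ hv⟩

end Perimeter

/-! ### Initial segments of the spiral -/

section Segment

/-- `g` strictly decreases up to `c` and strictly increases from `c` on. -/
def IsValley (g : ℤ → ℤ) (c : ℤ) : Prop :=
  (∀ x, c ≤ x → g x < g (x + 1)) ∧ ∀ x, x ≤ c → g x < g (x - 1)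

theorem IsValley.neg {g : ℤ → ℤ} {c : ℤ} (h : IsValley g c) : IsValley (fun t => g (-t)) (-c) := by
  refine ⟨fun x hx => ?_, fun x hx => ?_⟩
  · have := h.2 (-x) (by omega)
    rwa [show -x - 1 = -(x + 1) by ring] at this
  · have := h.1 (-x) (by omega)
    rwa [show -x + 1 = -(x - 1) by ring] at this

theorem IsValley.le_of_le {g : ℤ → ℤ} {c : ℤ} (h : IsValley g c) {x y : ℤ} (hx : c ≤ x)
    (hxy : x ≤ y) : g x ≤ g y := by
  induction y, hxy using Int.leInduction with
  | base => exact le_rfl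
  | succ y hy ih => exact ih.trans (h.1 y (hx.trans hy)).le

theorem IsValley.apply_le {g : ℤ → ℤ} {c : ℤ} (h : IsValley g c) (x : ℤ) : g c ≤ g x := by
  rcases le_total c x with hx | hx
  · exact h.le_of_le le_rfl hx
  · simpa using h.neg.le_of_le le_rfl (neg_le_neg hx)

theorem IsValley.not_lt_of_lt {g : ℤ → ℤ} {c n x y : ℤ} (h : IsValley g c) (hx : g x < n)
    (hx' : n ≤ g (x + 1)) (hy : g y < n) : ¬x < y := by
  intro hxy
  have hc : c ≤ x := by
    by_contra! hlt
    have := h.2 (x + 1) (by omega)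
    rw [add_sub_cancel_right] at this
    omega
  have := h.le_of_le (x := x + 1) (by omega) (show x + 1 ≤ y by omega)
  omega

theorem IsValley.eq_of_exits {g : ℤ → ℤ} {c n x y : ℤ} (h : IsValley g c) (hx : g x < n)
    (hx' : n ≤ g (x + 1)) (hy : g y < n) (hy' : n ≤ g (y + 1)) : x = y :=
  le_antisymm (not_lt.1 (h.not_lt_of_lt hy hy' hx)) (not_lt.1 (h.not_lt_of_lt hx hx' hy))

theorem isValley_row (y : ℤ) : IsValley (fun x => spiralIndex (x, y)) y :=
  ⟨fun _ h => spiralIndex_lt_right h, fun _ h => spiralIndex_lt_left h⟩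

theorem isValley_column (x : ℤ) : IsValley (fun y => spiralIndex (x, y)) (columnStart x).2 := by
  refine ⟨fun y h => ?_, fun y h => ?_⟩ <;> simp only [columnStart] at h <;> split_ifs at h
  · exact spiralIndex_lt_up (by omega) (by omega)
  · exact spiralIndex_lt_up (by omega) (by omega)
  · exact spiralIndex_lt_down (by omega) (by omega)
  · exact spiralIndex_lt_down (by omega) (by omega)

theorem spiralIndex_eq_symm (p : ℤ × ℤ) : spiralIndex p = spiral.symm p := by
  have h := spiralIndex_spiralPoint (spiral.symm p)
  rwa [show spiralPoint (spiral.symm p) = p from spiral.apply_symm_apply p] at h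

/-- The first `n` points of the spiral. -/
noncomputable def spiralSegment (n : ℕ) : Finset (ℤ × ℤ) :=
  (Finset.range n).map spiral.toEmbedding

theorem mem_spiralSegment {n : ℕ} {p : ℤ × ℤ} : p ∈ spiralSegment n ↔ spiralIndex p < n := by
  rw [spiralIndex_eq_symm, Nat.cast_lt, spiralSegment, Finset.mem_map_equiv, Finset.mem_range]

theorem card_exits_spiralSegment_right (n : ℕ) :
    (exits (spiralSegment n) (1, 0)).card ≤ ((spiralSegment n).image Prod.snd).card := by
  refine Finset.card_le_card_of_injOn Prod.snd
    (fun v hv => Finset.mem_image_of_mem _ (mem_exits.1 hv).1) ?_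
  rintro ⟨x, y⟩ hv ⟨x', y'⟩ hv' (rfl : y = y')
  simp only [Finset.mem_coe, mem_exits, mem_spiralSegment, Prod.mk_add_mk, add_zero, not_lt]
    at hv hv'
  rw [(isValley_row y).eq_of_exits hv.1 hv.2 hv'.1 hv'.2]

theorem card_exits_spiralSegment_left (n : ℕ) :
    (exits (spiralSegment n) (-1, 0)).card ≤ ((spiralSegment n).image Prod.snd).card := by
  refine Finset.card_le_card_of_injOn Prod.snd
    (fun v hv => Finset.mem_image_of_mem _ (mem_exits.1 hv).1) ?_
  rintro ⟨x, y⟩ hv ⟨x', y'⟩ hv' (rfl : y = y')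
  simp only [Finset.mem_coe, mem_exits, mem_spiralSegment, Prod.mk_add_mk, add_zero, not_lt]
    at hv hv'
  have := (isValley_row y).neg.eq_of_exits (x := -x) (y := -x') (n := n)
    (by simpa using hv.1) (by simpa [add_comm] using hv.2)
    (by simpa using hv'.1) (by simpa [add_comm] using hv'.2)
  rw [neg_inj.1 this]

theorem card_exits_spiralSegment_up (n : ℕ) :
    (exits (spiralSegment n) (0, 1)).card ≤ ((spiralSegment n).image Prod.fst).card := by
  refine Finset.card_le_card_of_injOn Prod.fst
    (fun v hv => Finset.mem_image_of_mem _ (mem_exits.1 hv).1) ?_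
  rintro ⟨x, y⟩ hv ⟨x', y'⟩ hv' (rfl : x = x')
  simp only [Finset.mem_coe, mem_exits, mem_spiralSegment, Prod.mk_add_mk, add_zero, not_lt]
    at hv hv'
  rw [(isValley_column x).eq_of_exits hv.1 hv.2 hv'.1 hv'.2]

theorem card_exits_spiralSegment_down (n : ℕ) :
    (exits (spiralSegment n) (0, -1)).card ≤ ((spiralSegment n).image Prod.fst).card := by
  refine Finset.card_le_card_of_injOn Prod.fst
    (fun v hv => Finset.mem_image_of_mem _ (mem_exits.1 hv).1) ?_
  rintro ⟨x, y⟩ hv ⟨x', y'⟩ hv' (rfl : x = x')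
  simp only [Finset.mem_coe, mem_exits, mem_spiralSegment, Prod.mk_add_mk, add_zero, not_lt]
    at hv hv'
  have := (isValley_column x).neg.eq_of_exits (x := -y) (y := -y') (n := n)
    (by simpa using hv.1) (by simpa [add_comm] using hv.2)
    (by simpa using hv'.1) (by simpa [add_comm] using hv'.2)
  rw [neg_inj.1 this]

theorem encard_edgeBoundary_spiralSegment_le (n : ℕ) :
    (edgeBoundary gridGraph (spiralSegment n)).encard ≤
      (2 * (((spiralSegment n).image Prod.fst).card +
        ((spiralSegment n).image Prod.snd).card) : ℕ) := by
  rw [encard_edgeBoundary, sum_unitSteps, Nat.cast_le]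
  have h₁ := card_exits_spiralSegment_right n
  have h₂ := card_exits_spiralSegment_left n
  have h₃ := card_exits_spiralSegment_up n
  have h₄ := card_exits_spiralSegment_down n
  omega

/-- The bounding rectangle of an initial segment of the spiral has the least perimeter among the
rectangles of at least its area. The column `x` is reached at the position `⌊m² / 4⌋` with
`m = |4x - 1| - 1`, the row `y` with `m = |4y - 1|`. These `m` are distinct, and they are less than
`a + b` when `⌊m² / 4⌋ < n ≤ ab`. -/
theorem card_image_spiralSegment_le {n a b : ℕ} (h : n ≤ a * b) :
    ((spiralSegment n).image Prod.fst).card + ((spiralSegment n).image Prod.snd).card ≤ a + b := by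
  rw [← Finset.card_disjSum, ← Finset.card_range (a + b)]
  have hab : 4 * (n : ℤ) ≤ ((a + b : ℕ) : ℤ) ^ 2 := by
    have h' : (n : ℤ) ≤ a * b := by exact_mod_cast h
    push_cast
    nlinarith [sq_nonneg ((a : ℤ) - b)]
  refine Finset.card_le_card_of_injOn
    (Sum.elim (fun x : ℤ => (|4 * x - 1| - 1).toNat) fun y : ℤ => (|4 * y - 1|).toNat) ?_ ?_
  · rintro (x | y) hz
    · simp only [Finset.mem_coe, Finset.inl_mem_disjSum, Finset.mem_image, mem_spiralSegment] at hz
      obtain ⟨⟨x, y⟩, hv, rfl⟩ := hz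
      have h₁ := (isValley_column x).apply_le y
      have h₂ := four_mul_spiralIndex_columnStart x
      have h₃ : (columnStart x) = (x, (columnStart x).2) := rfl
      simp only [← h₃] at h₁
      simp only [Sum.elim_inl, Finset.coe_range, Set.mem_Iio]
      have h₄ : |4 * x - 1| - 1 < ((a + b : ℕ) : ℤ) := by
        refine lt_of_pow_lt_pow_left₀ 2 (by positivity) ?_
        omega
      have h₅ := Int.one_le_abs (show 4 * x - 1 ≠ 0 by omega)
      omega
    · simp only [Finset.mem_coe, Finset.inr_mem_disjSum, Finset.mem_image, mem_spiralSegment] at hz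
      obtain ⟨⟨x, y⟩, hv, rfl⟩ := hz
      have h₁ := (isValley_row y).apply_le x
      have h₂ := four_mul_spiralIndex_row y
      simp only [Sum.elim_inr, Finset.coe_range, Set.mem_Iio]
      have h₄ : |4 * y - 1| < ((a + b : ℕ) : ℤ) := by
        refine lt_of_pow_lt_pow_left₀ 2 (by positivity) ?_
        omega
      have h₅ := Int.one_le_abs (show 4 * y - 1 ≠ 0 by omega)
      omega
  · rintro (x | x) - (y | y) - hxy <;>
      simp only [Sum.elim_inl, Sum.elim_inr, Sum.inl.injEq, Sum.inr.injEq, reduceCtorEq] at hxy ⊢ <;>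
      rcases abs_cases (4 * x - 1) with hx | hx <;> rcases abs_cases (4 * y - 1) with hy | hy <;>
      omega

/-- Edge-isoperimetric inequality in `ℤ²`. -/
theorem encard_edgeBoundary_spiralSegment_card_le (A : Finset (ℤ × ℤ)) :
    (edgeBoundary gridGraph (spiralSegment A.card)).encard ≤
      (edgeBoundary gridGraph A).encard := by
  refine (encard_edgeBoundary_spiralSegment_le _).trans
    (le_trans ?_ (two_mul_card_add_card_le_encard_edgeBoundary A))
  exact_mod_cast Nat.mul_le_mul_left 2
    (card_image_spiralSegment_le (card_le_card_image_mul_card_image A))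

end Segment

/-! ### Growth of neighbourhoods -/

section Growth

theorem card_add_two_le_of_nbhd {S T : Finset ℤ} (hS : S.Nonempty)
    (h : ∀ x ∈ S, x - 1 ∈ T ∧ x ∈ T ∧ x + 1 ∈ T) : S.card + 2 ≤ T.card := by
  have hmin : S.min' hS - 1 ∉ S := fun hm => by
    have := S.min'_le _ hm
    omega
  have hmax : S.max' hS + 1 ∉ insert (S.min' hS - 1) S := fun hm => by
    have := S.min'_le_max' hS
    rcases Finset.mem_insert.1 hm with h | h
    · omega
    · have := S.le_max' _ h
      omega
  have hsub : insert (S.max' hS + 1) (insert (S.min' hS - 1) S) ⊆ T := by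
    intro x hx
    rw [Finset.mem_insert, Finset.mem_insert] at hx
    rcases hx with rfl | rfl | hx
    · exact (h _ (S.max'_mem hS)).2.2
    · exact (h _ (S.min'_mem hS)).1
    · exact (h x hx).2.1
  have := Finset.card_le_card hsub
  rwa [Finset.card_insert_of_notMem hmax, Finset.card_insert_of_notMem hmin] at this

/-- `B` contains `A` and all its neighbours. -/
def ContainsNbhd (A B : Finset (ℤ × ℤ)) : Prop :=
  ∀ v ∈ A, v ∈ B ∧ ∀ w, gridGraph.Adj v w → w ∈ B

theorem ContainsNbhd.add_mem {A B : Finset (ℤ × ℤ)} (h : ContainsNbhd A B) {v d : ℤ × ℤ}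
    (hv : v ∈ A) (hd : d ∈ unitSteps) : v + d ∈ B :=
  (h v hv).2 _ (gridGraph_adj_iff.2 ⟨d, hd, rfl⟩)

theorem ContainsNbhd.card_columns {A B : Finset (ℤ × ℤ)} (h : ContainsNbhd A B)
    (hA : A.Nonempty) : (A.image Prod.fst).card + 2 ≤ (B.image Prod.fst).card := by
  refine card_add_two_le_of_nbhd (hA.image _) fun x hx => ?_
  obtain ⟨v, hv, rfl⟩ := Finset.mem_image.1 hx
  exact ⟨Finset.mem_image.2 ⟨_, h.add_mem (d := (-1, 0)) hv (by decide), rfl⟩,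
    Finset.mem_image_of_mem _ (h v hv).1,
    Finset.mem_image.2 ⟨_, h.add_mem (d := (1, 0)) hv (by decide), rfl⟩⟩

theorem ContainsNbhd.card_add_two_mul_columns {A B : Finset (ℤ × ℤ)} (h : ContainsNbhd A B) :
    A.card + 2 * (A.image Prod.fst).card ≤ B.card := by
  have hfiber : ∀ (C : Finset (ℤ × ℤ)) (x : ℤ),
      ((C.filter fun v => v.1 = x).image Prod.snd).card = (C.filter fun v => v.1 = x).card := by
    intro C x
    refine Finset.card_image_of_injOn ?_
    rintro ⟨a, b⟩ hv ⟨a', b'⟩ hv' (rfl : b = b')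
    simp only [Finset.coe_filter, Set.mem_ofPred_eq] at hv hv'
    rw [hv.2, hv'.2]
  have hle : ∀ x ∈ A.image Prod.fst,
      (A.filter fun v => v.1 = x).card + 2 ≤ (B.filter fun v => v.1 = x).card := by
    intro x hx
    rw [← hfiber A, ← hfiber B]
    obtain ⟨v, hv, rfl⟩ := Finset.mem_image.1 hx
    refine card_add_two_le_of_nbhd ⟨v.2, Finset.mem_image.2 ⟨v, by simp [hv], rfl⟩⟩ fun y hy => ?_
    obtain ⟨w, hw, rfl⟩ := Finset.mem_image.1 hy
    rw [Finset.mem_filter] at hw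
    refine ⟨Finset.mem_image.2 ⟨w + (0, -1), ?_, rfl⟩, Finset.mem_image.2 ⟨w, ?_, rfl⟩,
      Finset.mem_image.2 ⟨w + (0, 1), ?_, rfl⟩⟩
    · simpa [hw.2] using h.add_mem (d := (0, -1)) hw.1 (by decide)
    · simpa [hw.2] using (h w hw.1).1
    · simpa [hw.2] using h.add_mem (d := (0, 1)) hw.1 (by decide)
  calc A.card + 2 * (A.image Prod.fst).card
      = ∑ x ∈ A.image Prod.fst, ((A.filter fun v => v.1 = x).card + 2) := by
        rw [Finset.sum_add_distrib, ← Finset.card_eq_sum_card_image, Finset.sum_const, smul_eq_mul,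
          mul_comm]
    _ ≤ ∑ x ∈ A.image Prod.fst, (B.filter fun v => v.1 = x).card := Finset.sum_le_sum hle
    _ ≤ ∑ x ∈ B.image Prod.fst, (B.filter fun v => v.1 = x).card :=
        Finset.sum_le_sum_of_subset (Finset.image_subset_image fun v hv => (h v hv).1)
    _ = B.card := (Finset.card_eq_sum_card_image _ _).symm

theorem ContainsNbhd.map_swap {A B : Finset (ℤ × ℤ)} (h : ContainsNbhd A B) :
    ContainsNbhd (A.map (Equiv.prodComm ℤ ℤ).toEmbedding)
      (B.map (Equiv.prodComm ℤ ℤ).toEmbedding) := by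
  intro v hv
  rw [Finset.mem_map_equiv] at hv
  refine ⟨Finset.mem_map_equiv.2 (h _ hv).1, fun w hw => Finset.mem_map_equiv.2 ((h _ hv).2 _ ?_)⟩
  have hw : |v.1 - w.1| + |v.2 - w.2| = 1 := hw
  change |v.2 - w.2| + |v.1 - w.1| = 1
  omega

theorem ContainsNbhd.card_add_four_mul_columns {A B C : Finset (ℤ × ℤ)} (hA : A.Nonempty)
    (hAB : ContainsNbhd A B) (hBC : ContainsNbhd B C) :
    A.card + 4 * (A.image Prod.fst).card + 4 ≤ C.card := by
  have h₁ := hAB.card_columns hA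
  have h₂ := hAB.card_add_two_mul_columns
  have h₃ := hBC.card_add_two_mul_columns
  omega

/-- The points within distance two of `A` outnumber `A` by more than four times the square root of
the size of `A`. -/
theorem ContainsNbhd.exists_card_le_sq {A B C : Finset (ℤ × ℤ)} (hA : A.Nonempty)
    (hAB : ContainsNbhd A B) (hBC : ContainsNbhd B C) :
    ∃ m : ℕ, A.card ≤ m ^ 2 ∧ A.card + 4 * m + 4 ≤ C.card := by
  have h₁ := ContainsNbhd.card_add_four_mul_columns hA hAB hBC
  have h₂ := ContainsNbhd.card_add_four_mul_columns (hA.map) hAB.map_swap hBC.map_swap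
  have himage : (A.map (Equiv.prodComm ℤ ℤ).toEmbedding).image Prod.fst = A.image Prod.snd := by
    rw [Finset.map_eq_image, Finset.image_image]
    rfl
  rw [himage, Finset.card_map, Finset.card_map] at h₂
  have h₃ := card_le_card_image_mul_card_image A
  rcases le_total (A.image Prod.fst).card (A.image Prod.snd).card with hle | hle
  · exact ⟨_, h₃.trans (by rw [sq]; exact Nat.mul_le_mul_right _ hle), h₂⟩
  · exact ⟨_, h₃.trans (by rw [sq]; exact Nat.mul_le_mul_left _ hle), h₁⟩

/-- The points at distance at most one from `A`. -/
def closedNbhd (A : Finset (ℤ × ℤ)) : Finset (ℤ × ℤ) :=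
  A ∪ A.biUnion fun v => unitSteps.image (v + ·)

theorem mem_closedNbhd {A : Finset (ℤ × ℤ)} {w : ℤ × ℤ} :
    w ∈ closedNbhd A ↔ w ∈ A ∨ ∃ v ∈ A, gridGraph.Adj v w := by
  simp only [closedNbhd, Finset.mem_union, Finset.mem_biUnion, Finset.mem_image,
    gridGraph_adj_iff, eq_comm]

theorem containsNbhd_closedNbhd (A : Finset (ℤ × ℤ)) : ContainsNbhd A (closedNbhd A) :=
  fun v hv => ⟨mem_closedNbhd.2 (Or.inl hv), fun _ hw => mem_closedNbhd.2 (Or.inr ⟨v, hv, hw⟩)⟩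

theorem le_add_of_mem_closedNbhd {f : ℤ × ℤ → ℝ≥0} {A : Finset (ℤ × ℤ)} {t δ : ℝ≥0}
    (hf : ∀ v w, gridGraph.Adj v w → f v ≤ f w + δ) (hA : ∀ v ∈ A, t ≤ f v) :
    ∀ w ∈ closedNbhd A, t ≤ f w + δ := by
  intro w hw
  rcases mem_closedNbhd.1 hw with hw | ⟨v, hv, hvw⟩
  · exact (hA w hw).trans le_self_add
  · exact (hA v hv).trans (hf v w hvw)

end Growth

/-! ### Comparison of the gradients -/

section Comparison

theorem le_add_of_gradLinf_le {V : Type*} {G : SimpleGraph V} {f : V → ℝ≥0} {δ : ℝ≥0}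
    (h : gradLinf G f ≤ δ) {v w : V} (hvw : G.Adj v w) : f v ≤ f w + δ := by
  have h₁ : absGrad f s(v, w) ≤ δ :=
    (le_iSup (fun e : G.edgeSet => absGrad f e) ⟨s(v, w), hvw⟩).trans h
  rw [absGrad, Sym2.lift_mk, ENNReal.ofReal_le_coe] at h₁
  have h₂ : (f v : ℝ) ≤ f w + δ := by linarith [(abs_le.1 h₁).2]
  exact_mod_cast h₂

theorem rearrangement_le_add {f : ℤ × ℤ → ℝ≥0} (hf : BddAbove (Set.range f)) {δ : ℝ≥0}
    (hδ : ∀ v w, gridGraph.Adj v w → f v ≤ f w + δ) {p q : ℤ × ℤ} (h : gridGraph.Adj p q) :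
    rearrangement spiral f p ≤ rearrangement spiral f q + 2 * δ := by
  refine csSup_le (nonempty_levels f _) fun t ht => ?_
  have ht : ((spiral.symm p + 1 : ℕ) : ℕ∞) ≤ {x | t ≤ f x}.encard := ht
  rw [← tsub_le_iff_right]
  refine le_csSup (bddAbove_levels hf _) ?_
  obtain ⟨A, hA, hcard⟩ := Set.exists_subset_encard_eq ht
  lift A to Finset (ℤ × ℤ) using Set.finite_of_encard_eq_coe hcard
  rw [Set.encard_coe_eq_coe_finsetCard, Nat.cast_inj] at hcard
  obtain ⟨m, hm, hC⟩ := ContainsNbhd.exists_card_le_sq (Finset.card_pos.1 (by omega))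
    (containsNbhd_closedNbhd A) (containsNbhd_closedNbhd (closedNbhd A))
  have hpq := spiralIndex_le_of_adj h (m := m) (by positivity) (by
    rw [spiralIndex_eq_symm]
    have : spiral.symm p < m ^ 2 := by omega
    exact_mod_cast this)
  rw [spiralIndex_eq_symm, spiralIndex_eq_symm] at hpq
  -- Two steps from `A`, the function `f` has lost at most `2 * δ`.
  have hle : spiral.symm q + 1 ≤ (closedNbhd (closedNbhd A)).card := by omega
  have hsub : (closedNbhd (closedNbhd A) : Set (ℤ × ℤ)) ⊆ {x | t - 2 * δ ≤ f x} := by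
    intro x hx
    have h₁ := le_add_of_mem_closedNbhd hδ (fun v hv => hA hv)
    have h₂ := le_add_of_mem_closedNbhd (t := t - δ) hδ
      (fun v hv => tsub_le_iff_right.2 (h₁ v hv)) x hx
    rw [Set.mem_ofPred_eq, two_mul, ← tsub_tsub]
    exact tsub_le_iff_right.2 h₂
  have := Set.encard_le_encard hsub
  rw [Set.encard_coe_eq_coe_finsetCard] at this
  exact le_trans (by exact_mod_cast hle) this

theorem encard_edgeBoundary_rearrangement_le {f : ℤ × ℤ → ℝ≥0} (hf : BddAbove (Set.range f))
    (s : ℝ) : (edgeBoundary gridGraph {x | s < (rearrangement spiral f x : ℝ)}).encard ≤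
      (edgeBoundary gridGraph {x | s < (f x : ℝ)}).encard := by
  -- At negative levels both superlevel sets are the whole plane.
  rcases lt_or_ge s 0 with hs | hs
  · have : {x | s < (rearrangement spiral f x : ℝ)} = Set.univ :=
      Set.eq_univ_of_forall fun x => hs.trans_le (NNReal.coe_nonneg _)
    simp [this]
  lift s to ℝ≥0 using hs
  simp only [NNReal.coe_lt_coe]
  by_cases hfin : {x | s < f x}.Finite
  · lift {x | s < f x} to Finset (ℤ × ℤ) using hfin with A hA
    have hseg : {x | s < rearrangement spiral f x} = spiralSegment A.card := by
      rw [superlevel_rearrangement_of_finite hf spiral hA.symm]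
      ext x
      simp [mem_spiralSegment, spiralIndex_eq_symm]
    rw [hseg]
    exact encard_edgeBoundary_spiralSegment_card_le A
  · rw [superlevel_rearrangement_of_infinite hf spiral hfin]
    simp

end Comparison

/-! ### The rearrangement inequalities -/

theorem theorem1 (f : ℤ × ℤ → ℝ≥0) (hf : BddAbove (Set.range f)) :
    gradL1 gridGraph (rearrangement spiral f) ≤ gradL1 gridGraph f ∧
      gradLinf gridGraph (rearrangement spiral f) ≤ 2 * gradLinf gridGraph f := by
  constructor
  · rw [gradL1_eq_lintegral_edgeBoundary, gradL1_eq_lintegral_edgeBoundary]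
    exact MeasureTheory.lintegral_mono fun s =>
      ENat.toENNReal_le.2 (encard_edgeBoundary_rearrangement_le hf s)
  · rcases eq_or_ne (gradLinf gridGraph f) ⊤ with htop | htop
    · simp [htop]
    obtain ⟨δ, hδ⟩ : ∃ δ : ℝ≥0, (δ : ℝ≥0∞) = gradLinf gridGraph f :=
      ⟨_, ENNReal.coe_toNNReal htop⟩
    have hstep : ∀ v w, gridGraph.Adj v w → f v ≤ f w + δ :=
      fun v w => le_add_of_gradLinf_le hδ.ge
    refine iSup_le fun ⟨e, he⟩ => ?_
    induction e using Sym2.ind with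
    | _ p q =>
    have h₁ : (rearrangement spiral f p : ℝ) ≤ rearrangement spiral f q + 2 * δ := by
      exact_mod_cast rearrangement_le_add hf hstep he
    have h₂ : (rearrangement spiral f q : ℝ) ≤ rearrangement spiral f p + 2 * δ := by
      exact_mod_cast rearrangement_le_add hf hstep (SimpleGraph.Adj.symm he)
    rw [← hδ, absGrad, Sym2.lift_mk]
    have h₃ : ENNReal.ofReal |(rearrangement spiral f p : ℝ) - rearrangement spiral f q| ≤
        ((2 * δ : ℝ≥0) : ℝ≥0∞) := by
      rw [ENNReal.ofReal_le_coe, abs_le]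
      push_cast
      constructor <;> linarith
    simpa using h₃
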